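/- Let $(X,\rho)$ be a complete separable metric space with its Borel $\sigma$-algebra, and let $\mathcal M_1$ be the set of Borel probability measures on $X$. Write $B(x,r)$ for the ball with centre $x$ and radius $r$, and for $W\subset X$ let $\mathcal M_1^W$ be the set of $\mu\in\mathcal M_1$ whose support $\{x\in X:\mu(B(x,r))>0\text{ for all }r>0\}$ is contained in $W$. Let $(P_t)_{t\ge 0}$ be a Markov semigroup on $X$, i.e. $P_t\psi(x)=\int_X\psi(y)\,P_t(x,dy)$ for bounded Borel $\psi:X\to\mathbb R$, where the $P_t(x,\cdot)$ are Markov transition kernels, $P_0=\mathrm{Id}$ and $P_{s+t}=P_sP_t$. For $\mu\in\mathcal M_1$ put $P_t^*\mu(A)=\int_X P_t\mathbf 1_A\,d\mu$. Assume that $(P_t)$ is Feller ($P_t\psi$ is continuous for every bounded continuous $\psi$ and every $t$) and stochastically continuous ($\lim_{t\to0^+}P_t\psi(x)=\psi(x)$ for every $x\in X$ and every bounded continuous $\psi$). Suppose moreover that: 1. (e-property) for every bounded Lipschitz $\psi:X\to\mathbb R$, every $x\in X$ and every $\varepsilon>0$ there is $\delta>0$ such that $|P_t\psi(x)-P_t\psi(y)|<\varepsilon$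 for all $y\in B(x,\delta)$ and all $t\ge0$; 2. (averagely bounded) for every $\varepsilon>0$ and every bounded $A\subset X$ there is a bounded Borel set $B\subset X$ such that $\limsup_{T\to\infty}\frac1T\int_0^T P_s^*\mu(B)\,ds>1-\varepsilon$ for all $\mu\in\mathcal M_1^A$; 3. (concentrating at $z$) there is a point $z\in X$ such that for every $\varepsilon>0$ and every bounded $A\subset X$ there is $\alpha>0$ such that for any $\mu_1,\mu_2\in\mathcal M_1^A$ there is $t>0$ with $P_t^*\mu_i(B(z,\varepsilon))\ge\alpha$ for both $i=1,2$. Then $(P_t)$ is asymptotically stable: there is $\mu_*\in\mathcal M_1$ which is invariant, i.e. $\int_X P_t\psi\,d\mu_*=\int_X\psi\,d\mu_*$ for all bounded Borel $\psi$ and all $t\ge0$, and such that $P_t^*\mu$ converges weakly to $\mu_*$ as $t\to\infty$ for every $\mu\in\mathcal M_1$. In particular $\mu_*$ is the unique invariant probability measure. -/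

import Mathlib

open MeasureTheory ProbabilityTheory Filter Topology Set
open scoped NNReal BoundedContinuousFunction

/-- A Markov semigroup on `X`, given by its transition probabilities: `kernel t x A` is the
probability of being in `A` at time `t` when starting at `x`. The last two fields say `P₀ = Id` and
`Pₛ₊ₜ = Pₛ Pₜ`. -/
structure MarkovSemigroup (X : Type*) [MeasurableSpace X] where
  kernel : ℝ≥0 → Kernel X X
  isMarkovKernel : ∀ t, IsMarkovKernel (kernel t)
  kernel_zero : kernel 0 = Kernel.id
  kernel_add : ∀ s t, kernel (s + t) = (kernel t) ∘ₖ (kernel s)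

namespace MarkovSemigroup

attribute [instance] MarkovSemigroup.isMarkovKernel

/-- The operator `Pₜ`, to be applied to bounded Borel functions: `Pₜ ψ (x) = ∫ ψ(y) Pₜ(x, dy)`. -/
noncomputable def op {X : Type*} [MeasurableSpace X] (P : MarkovSemigroup X) (t : ℝ≥0)
    (ψ : X → ℝ) (x : X) : ℝ :=
  ∫ y, ψ y ∂(P.kernel t x)

/-- The dual `Pₜ*` acting on probability measures. -/
noncomputable def dual {X : Type*} [MeasurableSpace X] (P : MarkovSemigroup X) (t : ℝ≥0)
    (μ : ProbabilityMeasure X) : ProbabilityMeasure X :=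
  ⟨(P.kernel t) ∘ₘ (μ : Measure X), inferInstance⟩

/-- `⟨ψ, Pₜ* μ⟩ = ⟨Pₜ ψ, μ⟩` for bounded measurable `ψ`. -/
theorem integral_dual {X : Type*} [MeasurableSpace X] (P : MarkovSemigroup X) (t : ℝ≥0)
    (μ : ProbabilityMeasure X) (ψ : X → ℝ) (hψ : Measurable ψ) (C : ℝ) (hC : ∀ x, |ψ x| ≤ C) :
    ∫ x, ψ x ∂(P.dual t μ : Measure X) = ∫ x, P.op t ψ x ∂(μ : Measure X) := by
  have hi : Integrable ψ ((P.kernel t) ∘ₘ (μ : Measure X)) :=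
    Integrable.of_bound hψ.aestronglyMeasurable C (Eventually.of_forall hC)
  have h := Kernel.integral_comp (κ := Kernel.const Unit (μ : Measure X)) (η := P.kernel t)
    (a := ()) (f := ψ) (by rwa [Kernel.comp_apply, Kernel.const_apply])
  rw [Kernel.comp_apply, Kernel.const_apply] at h
  exact h

/-- `Pₜ* μ (A) = ⟨Pₜ 1_A, μ⟩`. -/
theorem dual_real {X : Type*} [MeasurableSpace X] (P : MarkovSemigroup X) (t : ℝ≥0)
    (μ : ProbabilityMeasure X) (A : Set X) (hA : MeasurableSet A) :
    (P.dual t μ : Measure X).real A = ∫ x, P.op t (A.indicator 1) x ∂(μ : Measure X) := by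
  rw [← P.integral_dual t μ _ (measurable_one.indicator hA) 1, integral_indicator_one hA]
  intro x
  by_cases h : x ∈ A <;> simp [h]

/-- The Feller property: `Pₜ` maps bounded continuous functions to continuous functions
(boundedness is automatic). -/
def IsFeller {X : Type*} [MeasurableSpace X] [TopologicalSpace X] (P : MarkovSemigroup X) : Prop :=
  ∀ (t : ℝ≥0) (ψ : X →ᵇ ℝ), Continuous (P.op t ψ)

/-- Stochastic continuity: `Pₜ ψ (x) → ψ (x)` as `t → 0⁺` for bounded continuous `ψ`. -/
def IsStochasticallyContinuous {X : Type*} [MeasurableSpace X] [TopologicalSpace X]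
    (P : MarkovSemigroup X) : Prop :=
  ∀ (ψ : X →ᵇ ℝ) (x : X), Tendsto (fun t : ℝ≥0 => P.op t ψ x) (𝓝[>] 0) (𝓝 (ψ x))

/-- The measure `μ` is supported in `W`: its support, the set of the points all of whose balls have
positive measure, is contained in `W`. -/
def SupportedIn {X : Type*} [MeasurableSpace X] [PseudoMetricSpace X]
    (μ : ProbabilityMeasure X) (W : Set X) : Prop :=
  {x : X | ∀ r > 0, 0 < (μ : Measure X) (Metric.ball x r)} ⊆ W

/-- The e-property. -/
def EProperty {X : Type*} [MeasurableSpace X] [PseudoMetricSpace X]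
    (P : MarkovSemigroup X) : Prop :=
  ∀ ψ : X →ᵇ ℝ, (∃ K : ℝ≥0, LipschitzWith K ψ) → ∀ x : X, ∀ ε > 0, ∃ δ > 0,
    ∀ z ∈ Metric.ball x δ, ∀ t : ℝ≥0, |P.op t ψ x - P.op t ψ z| < ε

/-- Average boundedness. -/
def IsAveragelyBounded {X : Type*} [MeasurableSpace X] [PseudoMetricSpace X]
    (P : MarkovSemigroup X) : Prop :=
  ∀ ε : ℝ, 0 < ε → ∀ A : Set X, Bornology.IsBounded A →
    ∃ B : Set X, MeasurableSet B ∧ Bornology.IsBounded B ∧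
      ∀ μ : ProbabilityMeasure X, SupportedIn μ A →
        1 - ε < limsup (fun T : ℝ =>
          1 / T * ∫ s in (0 : ℝ)..T, (P.dual s.toNNReal μ : Measure X).real B) atTop

/-- The semigroup is concentrating at `z`. The time `t` is common to both measures. -/
def IsConcentratingAt {X : Type*} [MeasurableSpace X] [PseudoMetricSpace X]
    (P : MarkovSemigroup X) (z : X) : Prop :=
  ∀ ε : ℝ, 0 < ε → ∀ A : Set X, Bornology.IsBounded A →
    ∃ α : ℝ, 0 < α ∧ ∀ μ₁ μ₂ : ProbabilityMeasure X, SupportedIn μ₁ A → SupportedIn μ₂ A →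
      ∃ t : ℝ≥0, 0 < t ∧
        α ≤ (P.dual t μ₁ : Measure X).real (Metric.ball z ε) ∧
        α ≤ (P.dual t μ₂ : Measure X).real (Metric.ball z ε)

/-- `μ` is invariant: `⟨Pₜ ψ, μ⟩ = ⟨ψ, μ⟩` for all bounded Borel `ψ` and all `t ≥ 0`. -/
def IsInvariant {X : Type*} [MeasurableSpace X] (P : MarkovSemigroup X)
    (μ : ProbabilityMeasure X) : Prop :=
  ∀ ψ : X → ℝ, Measurable ψ → (∃ C : ℝ, ∀ x, |ψ x| ≤ C) → ∀ t : ℝ≥0,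
    ∫ x, P.op t ψ x ∂(μ : Measure X) = ∫ x, ψ x ∂(μ : Measure X)

/-- Asymptotic stability; the topology on `ProbabilityMeasure X` is that of weak convergence. -/
def IsAsymptoticallyStable {X : Type*} [MeasurableSpace X] [TopologicalSpace X]
    [OpensMeasurableSpace X] (P : MarkovSemigroup X) : Prop :=
  ∃ μ₀ : ProbabilityMeasure X, P.IsInvariant μ₀ ∧
    ∀ μ : ProbabilityMeasure X, Tendsto (fun t : ℝ≥0 => P.dual t μ) atTop (𝓝 μ₀)

end MarkovSemigroup

namespace MarkovSemigroup

section Basic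

variable {X : Type*} [MeasurableSpace X]

theorem comp_kernel_add (P : MarkovSemigroup X) (s t : ℝ≥0) (ρ : Measure X) :
    P.kernel (s + t) ∘ₘ ρ = P.kernel t ∘ₘ (P.kernel s ∘ₘ ρ) := by
  rw [P.kernel_add, Measure.comp_assoc]

theorem comp_real_univ (P : MarkovSemigroup X) (t : ℝ≥0) (ρ : Measure X) :
    (P.kernel t ∘ₘ ρ).real univ = ρ.real univ := by
  simp [measureReal_def, Measure.bind_apply MeasurableSet.univ (P.kernel t).aemeasurable]

theorem comp_mono (P : MarkovSemigroup X) (t : ℝ≥0) {ρ ρ' : Measure X} (h : ρ ≤ ρ') :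
    P.kernel t ∘ₘ ρ ≤ P.kernel t ∘ₘ ρ' := by
  refine Measure.le_iff.2 fun s hs => ?_
  rw [Measure.bind_apply hs (P.kernel t).aemeasurable,
    Measure.bind_apply hs (P.kernel t).aemeasurable]
  exact lintegral_mono' h le_rfl

theorem comp_dirac (P : MarkovSemigroup X) (t : ℝ≥0) (x : X) :
    P.kernel t ∘ₘ Measure.dirac x = P.kernel t x :=
  Measure.dirac_bind (P.kernel t).measurable x

theorem dual_diracProba (P : MarkovSemigroup X) (t : ℝ≥0) (x : X) :
    (P.dual t (diracProba x) : Measure X) = P.kernel t x :=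
  P.comp_dirac t x

variable [TopologicalSpace X] [OpensMeasurableSpace X]

theorem integral_comp (P : MarkovSemigroup X) (t : ℝ≥0) (ρ : Measure X) [IsFiniteMeasure ρ]
    (ψ : X →ᵇ ℝ) : ∫ x, ψ x ∂(P.kernel t ∘ₘ ρ) = ∫ x, P.op t ψ x ∂ρ := by
  have h := Kernel.integral_comp (κ := Kernel.const Unit ρ) (η := P.kernel t)
    (a := ()) (f := ψ) (by
      rw [Kernel.comp_apply, Kernel.const_apply]
      exact ψ.integrable _)
  rwa [Kernel.comp_apply, Kernel.const_apply] at h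

theorem abs_op_le (P : MarkovSemigroup X) (t : ℝ≥0) (ψ : X →ᵇ ℝ) (x : X) :
    |P.op t ψ x| ≤ ‖ψ‖ :=
  ψ.norm_integral_le_norm (P.kernel t x)

/-- For a Feller semigroup, `Pₜ ψ` as a bounded continuous function. -/
noncomputable def IsFeller.bop {P : MarkovSemigroup X} (hF : P.IsFeller) (t : ℝ≥0) (ψ : X →ᵇ ℝ) :
    X →ᵇ ℝ :=
  BoundedContinuousFunction.ofNormedAddCommGroup (P.op t ψ) (hF t ψ) ‖ψ‖ (P.abs_op_le t ψ)

theorem IsFeller.integrable_op {P : MarkovSemigroup X} (hF : P.IsFeller) (t : ℝ≥0) (ψ : X →ᵇ ℝ)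
    (ρ : Measure X) [IsFiniteMeasure ρ] : Integrable (P.op t ψ) ρ :=
  (hF.bop t ψ).integrable ρ

theorem integral_op_comp (P : MarkovSemigroup X) (s t : ℝ≥0)
    (ψ : X →ᵇ ℝ) (ρ : Measure X) [IsFiniteMeasure ρ] :
    ∫ x, P.op t ψ x ∂(P.kernel s ∘ₘ ρ) = ∫ x, P.op (s + t) ψ x ∂ρ := by
  rw [← P.integral_comp (s + t), P.comp_kernel_add, P.integral_comp t]

theorem IsFeller.op_add {P : MarkovSemigroup X} (hF : P.IsFeller) (s t : ℝ≥0) (ψ : X →ᵇ ℝ)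
    (x : X) : P.op (s + t) ψ x = ∫ y, P.op t ψ y ∂(P.kernel s x) := by
  rw [← P.comp_dirac s x, P.integral_op_comp, integral_dirac']
  exact (hF _ ψ).measurable.stronglyMeasurable

end Basic

section Split

variable {X : Type*} [MeasurableSpace X]

/-- Part of the mass that a finite measure gives to a set can be split off. -/
theorem exists_add_eq_of_le_measureReal (μ : Measure X) [IsFiniteMeasure μ] {S : Set X}
    (hS : MeasurableSet S) {a : ℝ} (ha : 0 ≤ a) (haS : a ≤ μ.real S) :
    ∃ σ τ : Measure X, σ + τ = μ ∧ σ Sᶜ = 0 ∧ σ.real univ = a := by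
  obtain ⟨c, hc0, hc1, hca⟩ : ∃ c : ℝ, 0 ≤ c ∧ c ≤ 1 ∧ c * μ.real S = a := by
    rcases eq_or_lt_of_le (ha.trans haS) with h | h
    · exact ⟨0, le_rfl, zero_le_one, by linarith⟩
    · exact ⟨a / μ.real S, by positivity, (div_le_one h).2 haS, by field_simp⟩
  refine ⟨ENNReal.ofReal c • μ.restrict S,
    ENNReal.ofReal (1 - c) • μ.restrict S + μ.restrict Sᶜ, ?_, ?_, ?_⟩
  · rw [← add_assoc, ← add_smul, ← ENNReal.ofReal_add hc0 (by linarith)]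
    simp [Measure.restrict_add_restrict_compl hS]
  · simp [Measure.restrict_apply hS.compl]
  · simp [measureReal_def, ENNReal.toReal_ofReal hc0] at hca ⊢
    exact hca

end Split

section Metric

variable {X : Type*} [MeasurableSpace X] [MetricSpace X]

/-- Average boundedness yields a common bounded set that is charged at arbitrarily large times. -/
theorem IsAveragelyBounded.exists_large_times {P : MarkovSemigroup X} (h : P.IsAveragelyBounded)
    {A : Set X} (hA : Bornology.IsBounded A) {ε : ℝ} (hε : 0 < ε) :
    ∃ B : Set X, MeasurableSet B ∧ Bornology.IsBounded B ∧
      ∀ μ : ProbabilityMeasure X, SupportedIn μ A → ∀ S : ℝ≥0, ∃ s, S ≤ s ∧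
        1 - ε ≤ (P.dual s μ : Measure X).real B := by
  obtain ⟨B, hBm, hBb, hB⟩ := h ε hε A hA
  refine ⟨B, hBm, hBb, fun μ hμ S => ?_⟩
  by_contra! hlt
  refine absurd (hB μ hμ) (not_lt.2 ?_)
  have hε1 : 0 ≤ 1 - ε := measureReal_nonneg.trans (hlt S le_rfl).le
  set g : ℝ → ℝ := fun s => (P.dual s.toNNReal μ : Measure X).real B with hg
  have hg0 : ∀ s, 0 ≤ g s := fun s => measureReal_nonneg
  have hg1 : ∀ s, g s ≤ 1 := fun s => measureReal_le_one
  have hgS : ∀ s : ℝ, S ≤ s → g s ≤ 1 - ε := fun s hs =>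
    (hlt s.toNNReal (NNReal.le_toNNReal_of_coe_le hs)).le
  have hbound : ∀ T : ℝ, (S : ℝ) < T → 0 < T →
      1 / T * ∫ s in (0 : ℝ)..T, g s ≤ S * ε / T + (1 - ε) := by
    intro T hST hT
    have hi : ∀ c : ℝ, Integrable (fun _ : ℝ => c) (volume.restrict (Ioc 0 T)) :=
      fun c => integrable_const c
    have h1 : ∫ s in Ioc (0 : ℝ) T, g s ≤
        ∫ s in Ioc (0 : ℝ) T, ((1 - ε) + (Ioc (0 : ℝ) S).indicator (fun _ => ε) s) := by
      refine integral_mono_of_nonneg (Eventually.of_forall hg0)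
        ((hi (1 - ε)).add ((hi ε).indicator measurableSet_Ioc)) ?_
      refine (ae_restrict_iff' measurableSet_Ioc).2 (Eventually.of_forall fun s hs => ?_)
      by_cases hsS : s ∈ Ioc (0 : ℝ) S
      · simpa [hsS] using hg1 s
      · have : (S : ℝ) ≤ s := by
          by_contra! hc
          exact hsS ⟨hs.1, hc.le⟩
        simpa [hsS] using hgS s this
    have h2 : ∫ s in Ioc (0 : ℝ) T, ((1 - ε) + (Ioc (0 : ℝ) S).indicator (fun _ => ε) s) =
        T * (1 - ε) + S * ε := by
      rw [integral_add (hi _) ((hi _).indicator measurableSet_Ioc),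
        setIntegral_indicator measurableSet_Ioc, Ioc_inter_Ioc]
      simp [hST.le, hT.le]
    rw [intervalIntegral.integral_of_le hT.le]
    calc 1 / T * ∫ s in Ioc (0 : ℝ) T, g s ≤ 1 / T * (T * (1 - ε) + S * ε) := by
          rw [← h2]; gcongr
      _ = S * ε / T + (1 - ε) := by field_simp; ring
  have hlim : Tendsto (fun T : ℝ => S * ε / T + (1 - ε)) atTop (𝓝 (1 - ε)) := by
    simpa using (tendsto_const_nhds.div_atTop tendsto_id).add_const (1 - ε)
  rw [← hlim.limsup_eq]
  refine limsup_le_limsup ?_ ?_ hlim.isBoundedUnder_le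
  · filter_upwards [eventually_gt_atTop (S : ℝ), eventually_gt_atTop 0] with T h1 h2
    exact hbound T h1 h2
  · refine IsBoundedUnder.isCoboundedUnder_le ⟨0, ?_⟩
    rw [eventually_map]
    filter_upwards [eventually_gt_atTop 0] with T hT
    exact mul_nonneg (by positivity) (intervalIntegral.integral_nonneg hT.le fun s _ => hg0 s)

theorem supportedIn_closure_of_compl_eq_zero {μ : ProbabilityMeasure X} {B : Set X}
    (h : (μ : Measure X) Bᶜ = 0) : SupportedIn μ (closure B) := by
  intro x hx
  refine Metric.mem_closure_iff.2 fun r hr => ?_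
  by_contra! hc
  refine (hx r hr).ne' (measure_mono_null (fun y hy => ?_) h)
  refine fun hyB => (hc y hyB).not_gt ?_
  rwa [Metric.mem_ball, dist_comm] at hy

/-- The concentration property for finite measures that charge a given bounded set. -/
theorem IsConcentratingAt.exists_mass {P : MarkovSemigroup X} {z : X}
    (h : P.IsConcentratingAt z) {B : Set X} (hBm : MeasurableSet B)
    (hBb : Bornology.IsBounded B) {δ : ℝ} (hδ : 0 < δ) :
    ∃ α : ℝ, 0 < α ∧ ∀ (ρ₁ ρ₂ : Measure X) [IsFiniteMeasure ρ₁] [IsFiniteMeasure ρ₂]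
      (m : ℝ), 0 < m → m ≤ ρ₁.real B → m ≤ ρ₂.real B → ∃ t : ℝ≥0,
        α * m ≤ (P.kernel t ∘ₘ ρ₁).real (Metric.ball z δ) ∧
        α * m ≤ (P.kernel t ∘ₘ ρ₂).real (Metric.ball z δ) := by
  obtain ⟨α, hα, H⟩ := h δ hδ (closure B) hBb.closure
  refine ⟨α, hα, fun ρ₁ ρ₂ _ _ m hm h₁ h₂ => ?_⟩
  have key : ∀ (ρ : Measure X) [IsFiniteMeasure ρ], m ≤ ρ.real B →
      ∃ ν : ProbabilityMeasure X, SupportedIn ν (closure B) ∧ ∀ t : ℝ≥0,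
        α ≤ (P.dual t ν : Measure X).real (Metric.ball z δ) →
        α * m ≤ (P.kernel t ∘ₘ ρ).real (Metric.ball z δ) := by
    intro ρ _ hρ
    have hpos : 0 < ρ.real B := hm.trans_le hρ
    have hne : ρ B ≠ 0 := fun h0 => by simp [measureReal_def, h0] at hpos
    have := cond_isProbabilityMeasure hne
    refine ⟨⟨ρ[|B], this⟩, supportedIn_closure_of_compl_eq_zero ?_, fun t ht => ?_⟩
    · simp [cond_apply hBm]
    · have hd : (P.dual t ⟨ρ[|B], this⟩ : Measure X) =
          (ρ B)⁻¹ • (P.kernel t ∘ₘ (ρ.restrict B)) := Measure.comp_smul _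
      rw [hd, measureReal_ennreal_smul_apply, ENNReal.toReal_inv, ← measureReal_def] at ht
      have hle : (P.kernel t ∘ₘ (ρ.restrict B)).real (Metric.ball z δ) ≤
          (P.kernel t ∘ₘ ρ).real (Metric.ball z δ) :=
        ENNReal.toReal_mono (measure_ne_top _ _) (P.comp_mono t Measure.restrict_le_self _)
      calc α * m ≤ α * ρ.real B := by gcongr
        _ ≤ ((ρ.real B)⁻¹ * (P.kernel t ∘ₘ (ρ.restrict B)).real (Metric.ball z δ)) * ρ.real B := by
            gcongr
        _ = (P.kernel t ∘ₘ (ρ.restrict B)).real (Metric.ball z δ) := by field_simp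
        _ ≤ _ := hle
  obtain ⟨ν₁, hν₁, H₁⟩ := key ρ₁ h₁
  obtain ⟨ν₂, hν₂, H₂⟩ := key ρ₂ h₂
  obtain ⟨t, -, ht₁, ht₂⟩ := H ν₁ ν₂ hν₁ hν₂
  exact ⟨t, H₁ t ht₁, H₂ t ht₂⟩

end Metric

end MarkovSemigroup

namespace MarkovSemigroup

section Contraction

variable {X : Type*} [MeasurableSpace X] [MetricSpace X] [BorelSpace X]

theorem abs_integral_op_le (P : MarkovSemigroup X) (t : ℝ≥0) (ψ : X →ᵇ ℝ) (ρ : Measure X)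
    [IsFiniteMeasure ρ] : |∫ x, P.op t ψ x ∂ρ| ≤ ‖ψ‖ * ρ.real univ :=
  norm_integral_le_of_norm_le_const (f := P.op t ψ) (Eventually.of_forall (P.abs_op_le t ψ))

/-- A measure carried by a set on which `Pₜ ψ` is nearly constant. -/
theorem IsFeller.abs_integral_op_sub_le {P : MarkovSemigroup X} (hF : P.IsFeller) (t : ℝ≥0)
    (ψ : X →ᵇ ℝ) {c ε : ℝ} {S : Set X} (hS : ∀ y ∈ S, |c - P.op t ψ y| < ε)
    (σ : Measure X) [IsFiniteMeasure σ] (hσ : σ Sᶜ = 0) :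
    |(∫ x, P.op t ψ x ∂σ) - c * σ.real univ| ≤ ε * σ.real univ := by
  have h : (∫ x, P.op t ψ x ∂σ) - c * σ.real univ = ∫ x, (P.op t ψ x - c) ∂σ := by
    rw [integral_sub (hF.integrable_op t ψ σ) (integrable_const c)]
    simp [mul_comm]
  rw [h]
  refine norm_integral_le_of_norm_le_const (μ := σ) (f := fun x => P.op t ψ x - c) ?_
  have : ∀ᵐ x ∂σ, x ∈ S := hσ
  filter_upwards [this] with x hx
  rw [Real.norm_eq_abs, abs_sub_comm]
  exact (hS x hx).le

/-- Two parts of equal mass of the laws at time `T` are eventually indistinguishable by `ψ`, up to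
their distance `2 ε` near `z` and an error due to the mass outside a bounded set. The induction is
on the number of successive visits near `z` that exhaust the mass. -/
theorem IsFeller.eventually_abs_integral_sub_le {P : MarkovSemigroup X} (hF : P.IsFeller)
    (ψ : X →ᵇ ℝ) {z : X} {δ ε : ℝ} (hε : 0 ≤ ε)
    (hδ : ∀ y ∈ Metric.ball z δ, ∀ t, |P.op t ψ z - P.op t ψ y| < ε)
    {B : Set X} (hBm : MeasurableSet B) {α : ℝ} (hα0 : 0 < α)
    (hα : ∀ (ρ₁ ρ₂ : Measure X) [IsFiniteMeasure ρ₁] [IsFiniteMeasure ρ₂]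
      (m : ℝ), 0 < m → m ≤ ρ₁.real B → m ≤ ρ₂.real B → ∃ t : ℝ≥0,
        α * m ≤ (P.kernel t ∘ₘ ρ₁).real (Metric.ball z δ) ∧
        α * m ≤ (P.kernel t ∘ₘ ρ₂).real (Metric.ball z δ))
    {η : ℝ} (hη : 0 < η) (μ₁ μ₂ : Measure X) [IsProbabilityMeasure μ₁] [IsProbabilityMeasure μ₂]
    (hB : ∀ S : ℝ≥0, ∃ s, S ≤ s ∧ 1 - η ≤ (P.kernel s ∘ₘ μ₁).real B ∧
      1 - η ≤ (P.kernel s ∘ₘ μ₂).real B) (n : ℕ) :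
    ∀ (T : ℝ≥0) (ρ₁ ρ₂ : Measure X) (m : ℝ), ρ₁ ≤ P.kernel T ∘ₘ μ₁ → ρ₂ ≤ P.kernel T ∘ₘ μ₂ →
      ρ₁.real univ = m → ρ₂.real univ = m → (1 - α / 2) ^ n * m ≤ 2 * η →
      ∀ᶠ t in atTop, |(∫ x, P.op t ψ x ∂ρ₁) - ∫ x, P.op t ψ x ∂ρ₂| ≤
        2 * ε * m + 4 * η * ‖ψ‖ := by
  have small : ∀ (ρ₁ ρ₂ : Measure X) (m : ℝ) [IsFiniteMeasure ρ₁] [IsFiniteMeasure ρ₂],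
      ρ₁.real univ = m → ρ₂.real univ = m → m ≤ 2 * η → ∀ t,
      |(∫ x, P.op t ψ x ∂ρ₁) - ∫ x, P.op t ψ x ∂ρ₂| ≤ 2 * ε * m + 4 * η * ‖ψ‖ := by
    intro ρ₁ ρ₂ m _ _ h₁ h₂ hm t
    have b₁ := P.abs_integral_op_le t ψ ρ₁
    have b₂ := P.abs_integral_op_le t ψ ρ₂
    rw [h₁] at b₁
    rw [h₂] at b₂
    have hm0 : 0 ≤ m := h₁ ▸ measureReal_nonneg
    have := mul_le_mul_of_nonneg_left hm (norm_nonneg ψ)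
    have : 0 ≤ 2 * ε * m := by positivity
    refine (abs_sub _ _).trans ?_
    linarith
  induction n with
  | zero =>
    intro T ρ₁ ρ₂ m hle₁ hle₂ h₁ h₂ hm
    have := isFiniteMeasure_of_le _ hle₁
    have := isFiniteMeasure_of_le _ hle₂
    exact Eventually.of_forall (small ρ₁ ρ₂ m h₁ h₂ (by simpa using hm))
  | succ n ih =>
    intro T ρ₁ ρ₂ m hle₁ hle₂ h₁ h₂ hm
    have := isFiniteMeasure_of_le _ hle₁
    have := isFiniteMeasure_of_le _ hle₂
    rcases le_or_gt m (2 * η) with hmη | hmη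
    · exact Eventually.of_forall (small ρ₁ ρ₂ m h₁ h₂ hmη)
    obtain ⟨s, hTs, hs₁, hs₂⟩ := hB T
    obtain ⟨r, rfl⟩ := exists_add_of_le hTs
    have mass : ∀ (ρ μ : Measure X) [IsFiniteMeasure ρ] [IsProbabilityMeasure μ],
        ρ ≤ P.kernel T ∘ₘ μ → ρ.real univ = m → 1 - η ≤ (P.kernel (T + r) ∘ₘ μ).real B →
        m / 2 ≤ (P.kernel r ∘ₘ ρ).real B := by
      intro ρ μ _ _ hle hρ hs
      have hle' : (P.kernel r ∘ₘ ρ).real Bᶜ ≤ (P.kernel (T + r) ∘ₘ μ).real Bᶜ := by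
        rw [P.comp_kernel_add]
        exact ENNReal.toReal_mono (measure_ne_top _ _) (P.comp_mono r hle _)
      rw [probReal_compl_eq_one_sub (μ := P.kernel (T + r) ∘ₘ μ) hBm] at hle'
      have := measureReal_add_measureReal_compl (μ := P.kernel r ∘ₘ ρ) hBm
      rw [P.comp_real_univ, hρ] at this
      linarith
    obtain ⟨t, ht₁, ht₂⟩ := hα (P.kernel r ∘ₘ ρ₁) (P.kernel r ∘ₘ ρ₂) (m / 2) (by linarith)
      (mass ρ₁ μ₁ hle₁ h₁ hs₁) (mass ρ₂ μ₂ hle₂ h₂ hs₂)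
    rw [← P.comp_kernel_add] at ht₁ ht₂
    have hm0 : 0 < m := by linarith
    have ha : 0 ≤ α * (m / 2) := by positivity
    have split : ∀ (ρ μ : Measure X) [IsFiniteMeasure ρ] [IsProbabilityMeasure μ],
        ρ ≤ P.kernel T ∘ₘ μ → ρ.real univ = m →
        α * (m / 2) ≤ (P.kernel (r + t) ∘ₘ ρ).real (Metric.ball z δ) →
        ∃ τ : Measure X, τ ≤ P.kernel (T + (r + t)) ∘ₘ μ ∧ τ.real univ = (1 - α / 2) * m ∧
          ∀ u, |(∫ x, P.op (r + t + u) ψ x ∂ρ) - (∫ x, P.op u ψ x ∂τ)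
            - P.op u ψ z * (α * (m / 2))| ≤ ε * (α * (m / 2)) := by
      intro ρ μ _ _ hle hρ hball
      obtain ⟨σ, τ, hadd, hσ, hσm⟩ := exists_add_eq_of_le_measureReal _
        Metric.isOpen_ball.measurableSet ha hball
      have hσle : σ ≤ P.kernel (r + t) ∘ₘ ρ := hadd ▸ Measure.le_add_right le_rfl
      have hτle : τ ≤ P.kernel (r + t) ∘ₘ ρ := hadd ▸ Measure.le_add_left le_rfl
      have := isFiniteMeasure_of_le _ hσle
      have := isFiniteMeasure_of_le _ hτle
      refine ⟨τ, hτle.trans ?_, ?_, fun u => ?_⟩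
      · rw [P.comp_kernel_add T]
        exact P.comp_mono _ hle
      · have h := P.comp_real_univ (r + t) ρ
        rw [← hadd, measureReal_add_apply, hσm, hρ] at h
        linarith
      · rw [← P.integral_op_comp (r + t) u ψ ρ, ← hadd,
          integral_add_measure (hF.integrable_op u ψ σ) (hF.integrable_op u ψ τ), ← hσm,
          add_sub_cancel_right]
        exact hF.abs_integral_op_sub_le u ψ (fun y hy => hδ y hy u) σ hσ
    obtain ⟨τ₁, hτ₁, hτm₁, d₁⟩ := split ρ₁ μ₁ hle₁ h₁ ht₁
    obtain ⟨τ₂, hτ₂, hτm₂, d₂⟩ := split ρ₂ μ₂ hle₂ h₂ ht₂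
    have hev := ih (T + (r + t)) τ₁ τ₂ _ hτ₁ hτ₂ hτm₁ hτm₂
      (by rwa [← mul_assoc, ← pow_succ])
    obtain ⟨U, hU⟩ := eventually_atTop.1 hev
    filter_upwards [eventually_ge_atTop (r + t + U)] with v hv
    obtain ⟨w, rfl⟩ := exists_add_of_le hv
    have e := hU (U + w) le_self_add
    have e₁ := d₁ (U + w)
    have e₂ := d₂ (U + w)
    rw [← add_assoc (r + t)] at e₁ e₂
    rw [abs_le] at e e₁ e₂ ⊢
    constructor <;> linarith [e.1, e.2, e₁.1, e₁.2, e₂.1, e₂.2]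

theorem IsAveragelyBounded.exists_large_times_pair {P : MarkovSemigroup X}
    (h : P.IsAveragelyBounded) (x y : X) {η : ℝ} (hη : 0 < η) :
    ∃ B : Set X, MeasurableSet B ∧ Bornology.IsBounded B ∧ ∀ S : ℝ≥0, ∃ s, S ≤ s ∧
      1 - η ≤ (P.kernel s x).real B ∧ 1 - η ≤ (P.kernel s y).real B := by
  have hA : ({x, y} : Set X).Finite := toFinite _
  obtain ⟨B, hBm, hBb, hB⟩ := h.exists_large_times hA.isBounded (half_pos hη)
  refine ⟨B, hBm, hBb, fun S => ?_⟩
  set μ : Measure X := (2 : ENNReal)⁻¹ • (Measure.dirac x + Measure.dirac y) with hμ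
  have hp : IsProbabilityMeasure μ := ⟨by
    simp [hμ, ENNReal.inv_two_add_inv_two]⟩
  obtain ⟨s, hs, hsB⟩ := hB ⟨μ, hp⟩ (by
    rw [← hA.isClosed.closure_eq]
    refine supportedIn_closure_of_compl_eq_zero ?_
    simp [hμ]) S
  have hd : (P.dual s ⟨μ, hp⟩ : Measure X) = (2 : ENNReal)⁻¹ • (P.kernel s x + P.kernel s y) := by
    change P.kernel s ∘ₘ μ = _
    rw [hμ, Measure.comp_smul, Measure.comp_add, P.comp_dirac, P.comp_dirac]
  rw [hd, measureReal_ennreal_smul_apply, measureReal_add_apply] at hsB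
  have hx : (P.kernel s x).real B ≤ 1 := measureReal_le_one
  have hy : (P.kernel s y).real B ≤ 1 := measureReal_le_one
  simp only [ENNReal.toReal_inv, ENNReal.toReal_ofNat] at hsB
  exact ⟨s, hs, by linarith, by linarith⟩

/-- The trajectories of the dual semigroup that start at two points merge. -/
theorem IsFeller.tendsto_op_sub_op {P : MarkovSemigroup X} (hF : P.IsFeller)
    (hE : P.EProperty) (hbdd : P.IsAveragelyBounded) {z : X} (hconc : P.IsConcentratingAt z)
    (ψ : X →ᵇ ℝ) (hψ : ∃ K : ℝ≥0, LipschitzWith K ψ) (x y : X) :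
    Tendsto (fun t => P.op t ψ x - P.op t ψ y) atTop (𝓝 0) := by
  refine Metric.tendsto_nhds.2 fun ε hε => ?_
  obtain ⟨δ, hδ, hδε⟩ := hE ψ hψ z (ε / 8) (by positivity)
  set η : ℝ := ε / (16 * (‖ψ‖ + 1)) with hη
  have hψ0 := norm_nonneg ψ
  have hη0 : 0 < η := by positivity
  have hηε : 4 * η * ‖ψ‖ ≤ ε / 4 := by
    have : 4 * η * (‖ψ‖ + 1) = ε / 4 := by
      rw [hη]
      field_simp
      norm_num
    nlinarith
  obtain ⟨B, hBm, hBb, hB⟩ := hbdd.exists_large_times_pair x y hη0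
  obtain ⟨α, hα0, hα⟩ := hconc.exists_mass hBm hBb hδ
  obtain ⟨n, hn⟩ := exists_pow_lt_of_lt_one (y := 1 - α / 2) (mul_pos two_pos hη0) (by linarith)
  have := hF.eventually_abs_integral_sub_le ψ (by positivity) hδε hBm hα0 hα hη0
    (Measure.dirac x) (Measure.dirac y) (by simpa only [comp_dirac] using hB) n 0
    (P.kernel 0 x) (P.kernel 0 y) 1 (P.comp_dirac 0 x).ge (P.comp_dirac 0 y).ge (by simp) (by simp)
    (by linarith)
  filter_upwards [this] with t ht
  rw [← hF.op_add, ← hF.op_add, zero_add] at ht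
  rw [Real.dist_eq, sub_zero]
  linarith

theorem IsFeller.tendsto_integral_op_sub_op {P : MarkovSemigroup X} (hF : P.IsFeller)
    (hE : P.EProperty) (hbdd : P.IsAveragelyBounded) {z : X} (hconc : P.IsConcentratingAt z)
    (ψ : X →ᵇ ℝ) (hψ : ∃ K : ℝ≥0, LipschitzWith K ψ) (μ : Measure X) [IsProbabilityMeasure μ]
    (x : X) :
    Tendsto (fun t => (∫ y, P.op t ψ y ∂μ) - P.op t ψ x) atTop (𝓝 0) := by
  have h : ∀ t, (∫ y, P.op t ψ y ∂μ) - P.op t ψ x = ∫ y, (P.op t ψ y - P.op t ψ x) ∂μ := by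
    intro t
    rw [integral_sub (hF.integrable_op t ψ μ) (integrable_const _)]
    simp
  simp_rw [h]
  rw [← integral_zero X ℝ (μ := μ)]
  refine tendsto_integral_filter_of_dominated_convergence (fun _ => 2 * ‖ψ‖) ?_ ?_
    (integrable_const _) ?_
  · exact Eventually.of_forall fun t =>
      ((hF t ψ).sub continuous_const).measurable.aestronglyMeasurable
  · refine Eventually.of_forall fun t => Eventually.of_forall fun y => ?_
    refine (abs_sub _ _).trans ?_
    linarith [P.abs_op_le t ψ x, P.abs_op_le t ψ y]
  · exact Eventually.of_forall fun y => hF.tendsto_op_sub_op hE hbdd hconc ψ hψ y x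

/-- Along each trajectory the means of a Lipschitz function vary slowly in time. -/
theorem IsFeller.tendsto_op_add_sub_op {P : MarkovSemigroup X} (hF : P.IsFeller)
    (hE : P.EProperty) (hbdd : P.IsAveragelyBounded) {z : X} (hconc : P.IsConcentratingAt z)
    (ψ : X →ᵇ ℝ) (hψ : ∃ K : ℝ≥0, LipschitzWith K ψ) (r : ℝ≥0) (x : X) :
    Tendsto (fun t => P.op (t + r) ψ x - P.op t ψ x) atTop (𝓝 0) := by
  simp_rw [add_comm _ r, hF.op_add r]
  exact hF.tendsto_integral_op_sub_op hE hbdd hconc ψ hψ (P.kernel r x) x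

end Contraction

end MarkovSemigroup

namespace MarkovSemigroup

section Bumps

variable {X : Type*} [MetricSpace X]

/-- Lipschitz functions with disjoint supports can be summed over any set of indices. -/
theorem exists_lipschitz_sum {f : ℕ → X →ᵇ ℝ} {K : ℝ≥0} (hf0 : ∀ i x, 0 ≤ f i x)
    (hf1 : ∀ i x, f i x ≤ 1) (hfK : ∀ i, LipschitzWith K (f i))
    (hdisj : ∀ x i j, f i x ≠ 0 → f j x ≠ 0 → i = j) :
    ∃ F : (ℕ → Bool) → X →ᵇ ℝ, (∀ I, LipschitzWith K (F I)) ∧ (∀ I x, |F I x| ≤ 1) ∧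
      (∀ I x, (∀ i, f i x = 0) → F I x = 0) ∧
      ∀ I x i, f i x ≠ 0 → F I x = if I i then f i x else 0 := by
  set G : (ℕ → Bool) → X → ℝ := fun I x => ∑' i, if I i then f i x else 0 with hG
  have hz : ∀ I x, (∀ i, f i x = 0) → G I x = 0 := by
    intro I x h
    simp [hG, h]
  have hs : ∀ I x i, f i x ≠ 0 → G I x = if I i then f i x else 0 := by
    intro I x i hi
    refine tsum_eq_single i fun j hj => ?_
    have : f j x = 0 := by
      by_contra h
      exact hj (hdisj x j i h hi)
    simp [this]
  have h0 : ∀ I x, 0 ≤ G I x := fun I x => tsum_nonneg fun i => by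
    split_ifs
    exacts [hf0 i x, le_rfl]
  have h1 : ∀ I x, |G I x| ≤ 1 := by
    intro I x
    rw [abs_of_nonneg (h0 I x)]
    by_cases h : ∀ i, f i x = 0
    · rw [hz I x h]
      exact zero_le_one
    · push Not at h
      obtain ⟨i, hi⟩ := h
      rw [hs I x i hi]
      split_ifs
      exacts [hf1 i x, zero_le_one]
  have hL : ∀ I, LipschitzWith K (G I) := by
    refine fun I => LipschitzWith.of_le_add_mul K fun x y => ?_
    have hd : 0 ≤ K * dist x y := by positivity
    by_cases h : ∀ i, f i x = 0
    · rw [hz I x h]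
      exact add_nonneg (h0 I y) hd
    · push Not at h
      obtain ⟨i, hi⟩ := h
      rw [hs I x i hi]
      split_ifs with hI
      · have hy : f i y ≤ G I y := by
          by_cases hiy : f i y = 0
          · exact hiy ▸ h0 I y
          · rw [hs I y i hiy, if_pos hI]
        exact ((hfK i).le_add_mul x y).trans (by gcongr)
      · exact add_nonneg (h0 I y) hd
  exact ⟨fun I => BoundedContinuousFunction.ofNormedAddCommGroup (G I) (hL I).continuous 1 (h1 I),
    hL, h1, hz, hs⟩

variable [MeasurableSpace X] [BorelSpace X]

/-- For bumps with disjoint supports, the e-property is uniform in the bump: apply Baire's theorem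
to the sums over all sets of indices. -/
theorem EProperty.eventually_forall_abs_sub_le {P : MarkovSemigroup X} (hE : P.EProperty)
    {f : ℕ → X →ᵇ ℝ} {K : ℝ≥0} (hf0 : ∀ i x, 0 ≤ f i x)
    (hf1 : ∀ i x, f i x ≤ 1) (hfK : ∀ i, LipschitzWith K (f i))
    (hdisj : ∀ x i j, f i x ≠ 0 → f j x ≠ 0 → i = j) (z : X) {η : ℝ} (hη : 0 < η) :
    ∀ᶠ x in 𝓝 z, ∀ i t, |P.op t (f i) z - P.op t (f i) x| ≤ 2 * η := by
  obtain ⟨F, hFK, hF1, hFz, hFs⟩ := exists_lipschitz_sum hf0 hf1 hfK hdisj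
  have hcont : ∀ t x, Continuous fun I => P.op t (F I) x := by
    intro t x
    refine continuous_of_dominated (bound := fun _ => 1)
      (fun I => (F I).continuous.measurable.aestronglyMeasurable)
      (fun I => Eventually.of_forall (hF1 I)) (integrable_const _) (Eventually.of_forall fun y => ?_)
    by_cases h : ∀ i, f i y = 0
    · simp_rw [fun I => hFz I y h]
      exact continuous_const
    · push Not at h
      obtain ⟨i, hi⟩ := h
      simp_rw [fun I => hFs I y i hi]
      exact (continuous_of_discreteTopology (f := fun b : Bool => if b then f i y else 0)).comp
        (continuous_apply i)
  set C : ℕ → Set (ℕ → Bool) := fun m =>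
    {I | ∀ x ∈ Metric.ball z (1 / (m + 1 : ℝ)), ∀ t, |P.op t (F I) z - P.op t (F I) x| ≤ η} with hC
  have hclosed : ∀ m, IsClosed (C m) := by
    intro m
    simp only [hC, ofPred_forall]
    exact isClosed_iInter fun x => isClosed_iInter fun _ => isClosed_iInter fun t =>
      isClosed_le ((hcont t z).sub (hcont t x)).abs continuous_const
  have hunion : ⋃ m, C m = univ := by
    refine eq_univ_of_forall fun I => ?_
    obtain ⟨δ, hδ, H⟩ := hE (F I) ⟨K, hFK I⟩ z η hη
    obtain ⟨m, hm⟩ := exists_nat_one_div_lt hδ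
    exact mem_iUnion.2 ⟨m, fun x hx t => (H x (Metric.ball_subset_ball hm.le hx) t).le⟩
  obtain ⟨m, I₀, hI₀⟩ := nonempty_interior_of_iUnion_of_closed hclosed hunion
  obtain ⟨S, u, hu, hSu⟩ := isOpen_pi_iff.1 isOpen_interior I₀ hI₀
  have hupd : ∀ i ∉ S, ∀ b, Function.update I₀ i b ∈ C m := by
    refine fun i hi b => interior_subset (hSu fun j hj => ?_)
    rw [Function.update_of_ne (by rintro rfl; exact hi hj)]
    exact (hu j hj).2
  have hsmall : ∀ᶠ x in 𝓝 z, ∀ i ∈ S, ∀ t, |P.op t (f i) z - P.op t (f i) x| ≤ 2 * η := by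
    refine (eventually_all_finset S).2 fun i _ => ?_
    obtain ⟨δ, hδ, H⟩ := hE (f i) ⟨K, hfK i⟩ z (2 * η) (by positivity)
    filter_upwards [Metric.ball_mem_nhds z hδ] with x hx t
    exact (H x hx t).le
  filter_upwards [hsmall, Metric.ball_mem_nhds z (Nat.one_div_pos_of_nat (n := m))]
    with x hxS hx i t
  by_cases hi : i ∈ S
  · exact hxS i hi t
  have hop : ∀ y, P.op t (f i) y = P.op t (F (Function.update I₀ i true)) y -
      P.op t (F (Function.update I₀ i false)) y := by
    intro y
    unfold op
    rw [← integral_sub ((F _).integrable _) ((F _).integrable _)]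
    congr 1 with w
    by_cases h : ∀ j, f j w = 0
    · simp [hFz _ w h, h i]
    · push Not at h
      obtain ⟨j, hj⟩ := h
      rw [hFs _ w j hj, hFs _ w j hj]
      rcases eq_or_ne j i with rfl | hji
      · simp
      · have : f i w = 0 := by
          by_contra h
          exact hji (hdisj w j i hj h)
        simp [Function.update_of_ne hji, this]
  have e₁ := abs_le.1 (hupd i hi true x hx t)
  have e₂ := abs_le.1 (hupd i hi false x hx t)
  rw [hop, hop, abs_le]
  constructor <;> linarith [e₁.1, e₁.2, e₂.1, e₂.2]

end Bumps

section Tight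

variable {X : Type*} [MetricSpace X] [CompleteSpace X] [MeasurableSpace X]

theorem isTightMeasureSet_of_thickening {S : Set (Measure X)}
    (h : ∀ ε : ENNReal, 0 < ε → ∀ r : ℝ, 0 < r → ∃ K : Set X, IsCompact K ∧
      ∀ μ ∈ S, μ (Metric.thickening r K)ᶜ ≤ ε) : IsTightMeasureSet S := by
  refine isTightMeasureSet_iff_exists_isCompact_measure_compl_le.2 fun ε hε => ?_
  obtain ⟨ε', hε'0, hε'⟩ := ENNReal.exists_pos_sum_of_countable' hε.ne' ℕ
  choose K hK hKS using fun n : ℕ => h (ε' n) (hε'0 n) (1 / ((n : ℝ) + 1)) Nat.one_div_pos_of_nat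
  refine ⟨⋂ n : ℕ, Metric.cthickening (1 / (n + 1 : ℝ)) (K n), ?_, fun μ hμ => ?_⟩
  · refine TotallyBounded.isCompact_of_isClosed (Metric.totallyBounded_iff.2 fun r hr => ?_)
      (isClosed_iInter fun n => Metric.isClosed_cthickening)
    obtain ⟨n, hn⟩ := exists_nat_one_div_lt (half_pos hr)
    obtain ⟨t, ht, hKt⟩ := Metric.totallyBounded_iff.1 (hK n).totallyBounded _ (half_pos hr)
    refine ⟨t, ht, fun x hx => ?_⟩
    obtain ⟨y, hy, hxy⟩ := Metric.mem_thickening_iff.1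
      (Metric.cthickening_subset_thickening' (half_pos hr) hn (K n) (mem_iInter.1 hx n))
    obtain ⟨w, hw, hyw⟩ := mem_iUnion₂.1 (hKt hy)
    refine mem_iUnion₂.2 ⟨w, hw, ?_⟩
    rw [Metric.mem_ball] at hyw ⊢
    linarith [dist_triangle x y w]
  · rw [compl_iInter]
    calc μ (⋃ n : ℕ, (Metric.cthickening (1 / (n + 1 : ℝ)) (K n))ᶜ)
        ≤ ∑' n : ℕ, μ (Metric.cthickening (1 / (n + 1 : ℝ)) (K n))ᶜ := measure_iUnion_le _
      _ ≤ ∑' n, ε' n := ENNReal.tsum_le_tsum fun n =>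
          (measure_mono (compl_subset_compl.2 (Metric.thickening_subset_cthickening _ _))).trans
            (hKS n μ hμ)
      _ ≤ ε := hε'.le

variable [BorelSpace X] [TopologicalSpace.SeparableSpace X]

/-- A set of probability measures that is not tight charges a sequence of separated compact
sets. -/
theorem exists_separated_compacts_of_not_isTightMeasureSet {ι : Type*} {μ : ι → Measure X}
    [∀ i, IsProbabilityMeasure (μ i)] (h : ¬ IsTightMeasureSet (range μ)) :
    ∃ c > 0, ∃ r > 0, ∃ (K : ℕ → Set X) (τ : ℕ → ι), (∀ n, IsCompact (K n)) ∧
      (∀ n, c ≤ (μ (τ n)).real (K n)) ∧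
      ∀ m n, m < n → Disjoint (K n) (Metric.thickening r (K m)) := by
  have h' := mt isTightMeasureSet_of_thickening h
  push Not at h'
  obtain ⟨ε, hε, r, hr, H⟩ := h'
  have hεt : ε ≠ ⊤ := by
    obtain ⟨ν, -, hν⟩ := H ∅ isCompact_empty
    exact hν.ne_top
  have := UniformSpace.secondCountable_of_separable X
  obtain ⟨f, hf, hf'⟩ := exists_seq_of_forall_finset_exists
    (fun p : Set X × ι => IsCompact p.1 ∧ ε.toReal ≤ (μ p.2).real p.1)
    (fun p q => Disjoint q.1 (Metric.thickening r p.1)) (by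
      intro s hs
      obtain ⟨_, ⟨i, rfl⟩, hi⟩ := H (⋃ p ∈ s, p.1) (s.isCompact_biUnion fun p hp => (hs p hp).1)
      obtain ⟨L, hLsub, ⟨hLc, -⟩, hL⟩ := innerRegular_isCompact_isClosed_measurableSet_of_finite
        (μ i) Metric.isOpen_thickening.isClosed_compl.measurableSet ε hi
      refine ⟨(L, i), ⟨hLc, ENNReal.toReal_mono (measure_ne_top _ _) hL.le⟩, fun p hp => ?_⟩
      refine disjoint_left.2 fun x hx hxp => hLsub hx ?_
      exact Metric.thickening_subset_of_subset r (subset_biUnion_of_mem hp) hxp)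
  exact ⟨ε.toReal, ENNReal.toReal_pos hε.ne' hεt, r, hr, fun n => (f n).1, fun n => (f n).2,
    fun n => (hf n).1, fun n => (hf n).2, hf'⟩

theorem IsFeller.isTightMeasureSet_range_kernel {P : MarkovSemigroup X} (hF : P.IsFeller)
    (hE : P.EProperty) (hbdd : P.IsAveragelyBounded) {z : X} (hconc : P.IsConcentratingAt z) :
    IsTightMeasureSet (range fun t => P.kernel t z) := by
  by_contra hnt
  obtain ⟨c, hc, r, hr, K, τ, hK, hcK, hsep⟩ :=
    exists_separated_compacts_of_not_isTightMeasureSet hnt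
  have hr2 := half_pos hr
  set f : ℕ → X →ᵇ ℝ := fun n => BoundedContinuousFunction.ofNormedAddCommGroup
    (fun x => (thickenedIndicator hr2 (K n) x : ℝ))
    (NNReal.continuous_coe.comp (thickenedIndicator hr2 (K n)).continuous) 1 (fun x => by
      simpa using thickenedIndicator_le_one hr2 (K n) x) with hf
  have hf0 : ∀ i x, 0 ≤ f i x := fun i x => NNReal.coe_nonneg _
  have hf1 : ∀ i x, f i x ≤ 1 := fun i x => thickenedIndicator_le_one hr2 (K i) x
  have hfL : ∀ i, LipschitzWith (r / 2).toNNReal⁻¹ (f i) := fun i =>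
    lipschitzWith_thickenedIndicator hr2 (K i)
  have hsupp : ∀ i x, f i x ≠ 0 → x ∈ Metric.thickening (r / 2) (K i) := by
    intro i x hx
    by_contra hxK
    exact hx (congrArg NNReal.toReal (thickenedIndicator_zero hr2 (K i) hxK))
  have hlt : ∀ x i j, i < j → f i x ≠ 0 → f j x ≠ 0 → False := by
    intro x i j hij hi hj
    obtain ⟨a, ha, hxa⟩ := Metric.mem_thickening_iff.1 (hsupp i x hi)
    obtain ⟨b, hb, hxb⟩ := Metric.mem_thickening_iff.1 (hsupp j x hj)
    refine disjoint_left.1 (hsep i j hij) hb (Metric.mem_thickening_iff.2 ⟨a, ha, ?_⟩)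
    linarith [dist_triangle_left b a x]
  have hdisj : ∀ x i j, f i x ≠ 0 → f j x ≠ 0 → i = j := by
    intro x i j hi hj
    rcases lt_trichotomy i j with h | h | h
    exacts [(hlt x i j h hi hj).elim, h, (hlt x j i h hj hi).elim]
  have hfz : ∀ n, c ≤ P.op (τ n) (f n) z := by
    intro n
    refine (hcK n).trans ?_
    rw [← integral_indicator_one (hK n).measurableSet]
    refine integral_mono ((integrable_const (1 : ℝ)).indicator (hK n).measurableSet)
      ((f n).integrable _) fun x => ?_
    by_cases hx : x ∈ K n
    · have : f n x = 1 := congrArg NNReal.toReal (thickenedIndicator_one hr2 (K n) hx)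
      simp [this, hx]
    · simpa [hx] using hf0 n x
  obtain ⟨δ, hδ, hball⟩ := Metric.eventually_nhds_iff_ball.1
    (hE.eventually_forall_abs_sub_le hf0 hf1 hfL hdisj z (by positivity : 0 < c / 4))
  obtain ⟨B, hBm, hBb, hB⟩ := hbdd.exists_large_times_pair z z one_half_pos
  obtain ⟨α, hα, hmass⟩ := hconc.exists_mass hBm hBb hδ
  have hret : ∀ S : ℝ≥0, ∃ T, S ≤ T ∧ α / 2 ≤ (P.kernel T z).real (Metric.ball z δ) := by
    intro S
    obtain ⟨s, hSs, hs, -⟩ := hB S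
    obtain ⟨t, ht, -⟩ := hmass (P.kernel s z) (P.kernel s z) (1 / 2) one_half_pos
      (by linarith) (by linarith)
    refine ⟨s + t, hSs.trans le_self_add, ?_⟩
    rw [← P.comp_dirac (s + t), P.comp_kernel_add, P.comp_dirac]
    linarith
  obtain ⟨N, hN⟩ := exists_nat_gt (8 / (c * α))
  have hslow : ∀ᶠ T in atTop, ∀ n ∈ Finset.range N,
      |P.op (T + τ n) (f n) z - P.op T (f n) z| < c * α / 8 := by
    refine (eventually_all_finset _).2 fun n _ => ?_
    have := Metric.tendsto_nhds.1
      (hF.tendsto_op_add_sub_op hE hbdd hconc (f n) ⟨_, hfL n⟩ (τ n) z) (c * α / 8) (by positivity)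
    simpa [Real.dist_eq] using this
  obtain ⟨S, hS⟩ := eventually_atTop.1 hslow
  obtain ⟨T, hST, hT⟩ := hret S
  have hlow : ∀ n ∈ Finset.range N, c * α / 8 ≤ P.op T (f n) z := by
    intro n hn
    have h1 : c / 2 * (α / 2) ≤ P.op (T + τ n) (f n) z := by
      rw [hF.op_add]
      calc c / 2 * (α / 2) ≤ c / 2 * (P.kernel T z).real (Metric.ball z δ) := by gcongr
        _ = ∫ y, (Metric.ball z δ).indicator (fun _ => c / 2) y ∂(P.kernel T z) := by
          rw [integral_indicator_const _ Metric.isOpen_ball.measurableSet, smul_eq_mul, mul_comm]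
        _ ≤ ∫ y, P.op (τ n) (f n) y ∂(P.kernel T z) := by
          refine integral_mono ((integrable_const _).indicator Metric.isOpen_ball.measurableSet)
            (hF.integrable_op _ _ _) fun y => ?_
          by_cases hy : y ∈ Metric.ball z δ
          · have := (abs_le.1 (hball y hy n (τ n))).2
            simp only [indicator_of_mem hy]
            linarith [hfz n]
          · simp only [indicator_of_notMem hy]
            exact integral_nonneg (hf0 n)
    have := (abs_lt.1 (hS T hST n hn)).2
    linarith
  have hsum : ∑ n ∈ Finset.range N, P.op T (f n) z ≤ 1 := by
    unfold op
    rw [← integral_finsetSum _ fun n _ => (f n).integrable _]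
    refine (integral_mono (integrable_finsetSum _ fun n _ => (f n).integrable _)
      (integrable_const (1 : ℝ)) fun y => ?_).trans_eq (by simp)
    by_cases h : ∃ i ∈ Finset.range N, f i y ≠ 0
    · obtain ⟨i, hi, hiy⟩ := h
      refine (Finset.sum_eq_single_of_mem i hi fun j _ hj => ?_).trans_le (hf1 i y)
      by_contra hjy
      exact hj (hdisj y j i hjy hiy)
    · push Not at h
      exact (Finset.sum_eq_zero h).trans_le zero_le_one
  have := (Finset.card_nsmul_le_sum _ _ _ hlow).trans hsum
  rw [Finset.card_range, nsmul_eq_mul] at this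
  rw [div_lt_iff₀ (by positivity)] at hN
  linarith

end Tight

end MarkovSemigroup

namespace MarkovSemigroup

section Stability

variable {X : Type*} [MetricSpace X] [MeasurableSpace X] [BorelSpace X]

theorem isInvariant_iff_dual_eq {P : MarkovSemigroup X} {μ : ProbabilityMeasure X} :
    P.IsInvariant μ ↔ ∀ t, P.dual t μ = μ := by
  constructor
  · intro h t
    have h' : (P.dual t μ : Measure X) = μ :=
      ext_of_forall_integral_eq_of_IsFiniteMeasure fun ψ => by
        rw [P.integral_dual t μ ψ ψ.continuous.measurable ‖ψ‖ ψ.norm_coe_le_norm]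
        exact h ψ ψ.continuous.measurable ⟨‖ψ‖, ψ.norm_coe_le_norm⟩ t
    exact Subtype.ext h'
  · rintro h ψ hψ ⟨C, hC⟩ t
    rw [← P.integral_dual t μ ψ hψ C hC, h t]

theorem eq_of_forall_lipschitz_integral_eq {μ ν : ProbabilityMeasure X}
    (h : ∀ ψ : X →ᵇ ℝ, (∃ K : ℝ≥0, LipschitzWith K ψ) →
      ∫ x, ψ x ∂(μ : Measure X) = ∫ x, ψ x ∂(ν : Measure X)) : μ = ν := by
  have : Tendsto (fun _ : ℕ => μ) atTop (𝓝 ν) := by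
    refine tendsto_iff_forall_lipschitz_integral_tendsto.2 fun f ⟨C, hC⟩ ⟨L, hL⟩ => ?_
    have := h (BoundedContinuousFunction.mkOfBound ⟨f, hL.continuous⟩ C hC) ⟨L, hL⟩
    exact tendsto_const_nhds.congr fun _ => this.symm
  exact tendsto_nhds_unique tendsto_const_nhds this

/-- A cluster point of a trajectory along which Lipschitz means vary slowly is invariant. -/
theorem IsFeller.isInvariant_of_tendsto {P : MarkovSemigroup X} (hF : P.IsFeller) {x : X}
    (hslow : ∀ ψ : X →ᵇ ℝ, (∃ K : ℝ≥0, LipschitzWith K ψ) → ∀ r : ℝ≥0,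
      Tendsto (fun t => P.op (t + r) ψ x - P.op t ψ x) atTop (𝓝 0))
    {l : Filter ℝ≥0} [l.NeBot] (hl : l ≤ atTop) {μ : ProbabilityMeasure X}
    (h : Tendsto (fun t => P.dual t (diracProba x)) l (𝓝 μ)) : P.IsInvariant μ := by
  refine isInvariant_iff_dual_eq.2 fun r => eq_of_forall_lipschitz_integral_eq fun ψ hψ => ?_
  have h' := ProbabilityMeasure.tendsto_iff_forall_integral_tendsto.1 h
  simp_rw [dual_diracProba] at h'
  have h1 : Tendsto (fun t => P.op (t + r) ψ x) l (𝓝 (∫ y, P.op r ψ y ∂(μ : Measure X))) := by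
    simp_rw [hF.op_add]
    exact h' (hF.bop r ψ)
  have h2 : Tendsto (fun t => P.op (t + r) ψ x) l (𝓝 (∫ y, ψ y ∂(μ : Measure X))) := by
    have h3 := ((hslow ψ hψ r).mono_left hl).add (h' ψ)
    rw [zero_add] at h3
    exact h3.congr fun t => sub_add_cancel _ _
  rw [P.integral_dual r μ ψ ψ.continuous.measurable ‖ψ‖ ψ.norm_coe_le_norm]
  exact tendsto_nhds_unique h1 h2

theorem IsFeller.tendsto_dual {P : MarkovSemigroup X} (hF : P.IsFeller)
    (hE : P.EProperty) (hbdd : P.IsAveragelyBounded) {z : X} (hconc : P.IsConcentratingAt z)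
    {μ₀ : ProbabilityMeasure X} (hμ₀ : P.IsInvariant μ₀) (μ : ProbabilityMeasure X) :
    Tendsto (fun t => P.dual t μ) atTop (𝓝 μ₀) := by
  refine tendsto_iff_forall_lipschitz_integral_tendsto.2 fun f ⟨C, hC⟩ ⟨L, hL⟩ => ?_
  set ψ : X →ᵇ ℝ := BoundedContinuousFunction.mkOfBound ⟨f, hL.continuous⟩ C hC with hψ
  have hint : ∀ (ν : ProbabilityMeasure X) t,
      ∫ y, f y ∂(P.dual t ν : Measure X) = ∫ y, P.op t ψ y ∂(ν : Measure X) := fun ν t =>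
    P.integral_dual t ν ψ ψ.continuous.measurable ‖ψ‖ ψ.norm_coe_le_norm
  have h1 := hF.tendsto_integral_op_sub_op hE hbdd hconc ψ ⟨L, hL⟩ (μ : Measure X) z
  have h2 := hF.tendsto_integral_op_sub_op hE hbdd hconc ψ ⟨L, hL⟩ (μ₀ : Measure X) z
  have h3 := (h1.sub h2).add_const (∫ y, f y ∂(μ₀ : Measure X))
  rw [sub_zero, zero_add] at h3
  refine h3.congr fun t => ?_
  rw [← hint, ← hint, isInvariant_iff_dual_eq.1 hμ₀ t]
  ring

theorem IsFeller.exists_isInvariant [CompleteSpace X] [TopologicalSpace.SeparableSpace X]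
    {P : MarkovSemigroup X} (hF : P.IsFeller)
    (hE : P.EProperty) (hbdd : P.IsAveragelyBounded) {z : X} (hconc : P.IsConcentratingAt z) :
    ∃ μ₀ : ProbabilityMeasure X, P.IsInvariant μ₀ := by
  set u : ℝ≥0 → ProbabilityMeasure X := fun t => P.dual t (diracProba z) with hu
  have htight : IsTightMeasureSet {((μ : ProbabilityMeasure X) : Measure X) | μ ∈ range u} := by
    refine (hF.isTightMeasureSet_range_kernel hE hbdd hconc).subset ?_
    rintro _ ⟨_, ⟨t, rfl⟩, rfl⟩
    exact ⟨t, (P.dual_diracProba t z).symm⟩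
  have hev : ∀ᶠ t in atTop, u t ∈ closure (range u) :=
    Eventually.of_forall fun t => subset_closure (mem_range_self t)
  obtain ⟨μ₀, -, hμ₀⟩ :=
    (isCompact_closure_of_isTightMeasureSet htight).exists_mapClusterPt_of_frequently hev.frequently
  obtain ⟨l, hl, hlim⟩ := mapClusterPt_iff_ultrafilter.1 hμ₀
  exact ⟨μ₀, hF.isInvariant_of_tendsto
    (fun ψ hψ r => hF.tendsto_op_add_sub_op hE hbdd hconc ψ hψ r z) hl hlim⟩

end Stability

end MarkovSemigroup

theorem mainTheorem1 {X : Type*} [MetricSpace X] [CompleteSpace X] [TopologicalSpace.SeparableSpace X]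
    [MeasurableSpace X] [BorelSpace X] (P : MarkovSemigroup X)
    (hFeller : P.IsFeller) (hcont : P.IsStochasticallyContinuous)
    (hE : P.EProperty) (hbdd : P.IsAveragelyBounded)
    (z : X) (hconc : P.IsConcentratingAt z) :
    P.IsAsymptoticallyStable ∧ ∃! μ : ProbabilityMeasure X, P.IsInvariant μ := by
  obtain ⟨μ₀, hμ₀⟩ := hFeller.exists_isInvariant hE hbdd hconc
  refine ⟨⟨μ₀, hμ₀, hFeller.tendsto_dual hE hbdd hconc hμ₀⟩, μ₀, hμ₀, fun ν hν => ?_⟩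
  have h := hFeller.tendsto_dual hE hbdd hconc hμ₀ ν
  simp_rw [MarkovSemigroup.isInvariant_iff_dual_eq.1 hν] at h
  exact tendsto_nhds_unique tendsto_const_nhds h
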